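/- Let $A$ be a (real or complex, not necessarily unital) Banach algebra, let $A^{**}$ carry the first Arens product $\langle mn,f\rangle=\langle m,n\cdot f\rangle$, where $\langle n\cdot f,a\rangle=\langle n,f\cdot a\rangle$ and $\langle f\cdot a,b\rangle=\langle f,ab\rangle$ for $m,n\in A^{**}$, $f\in A^*$, $a,b\in A$, and regard $A$ as a subalgebra of $A^{**}$ via the canonical embedding. Suppose that $A$ is a two-sided ideal in $A^{**}$ and that $A^*$ factors, on at least one side (in particular, if it factors on both): every $f\in A^*$ is of the form $f=g\cdot a$ with $g\in A^*$, $a\in A$, or every $f\in A^*$ is of the form $f=a\cdot g$ with $a\in A$, $g\in A^*$; here $\langle g\cdot a,b\rangle=\langle g,ab\rangle$ and $\langle a\cdot g,b\rangle=\langle g,ba\rangle$. Then $A^{**}$ is a dual Banach algebra with predual $A^*$ (that is, $A^*$ is a sub-bimodule of the $A^{**}$-bimodule $A^{***}$), and $A$ is amenable if and only if $A^{**}$ is Connes-amenable. Here $A$ is amenable if, for every Banach $A$-bimodule $X$, every bounded derivation $D\colon A\to X^*$ (that is, $D(ab)=a\cdot D(b)+D(a)\cdot b$) is inner, i.e. of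 the form $D(a)=a\cdot\phi-\phi\cdot a$ for some $\phi\in X^*$. A dual Banach $A^{**}$-bimodule is the dual $X^*$ of a Banach $A^{**}$-bimodule $X$, with the dual actions; it is normal if for every $\phi\in X^*$ the maps $m\mapsto m\cdot\phi$ and $m\mapsto\phi\cdot m$ from $A^{**}$ to $X^*$ are weak$^*$-weak$^*$ continuous, for the weak$^*$ topologies $\sigma(A^{**},A^*)$ and $\sigma(X^*,X)$. The algebra $A^{**}$ is Connes-amenable if every bounded weak$^*$-weak$^*$ continuous derivation from $A^{**}$ into a normal dual Banach $A^{**}$-bimodule is inner. The equivalence also holds if, in this definition, all dual Banach $A^{**}$-bimodules, normal or not, are allowed. -/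

import Mathlib

universe u

section Bimodules

variable (𝕜 : Type) [RCLike 𝕜]
variable (B : Type u) [NonUnitalNormedRing B] [NormedSpace 𝕜 B]
variable (X : Type u) [NormedAddCommGroup X] [NormedSpace 𝕜 X]

/-- A bimodule structure on the normed space `X` over the normed algebra `B`, with jointly
continuous (i.e. bounded bilinear) actions: `left b x` is `b · x` and `right b x` is `x · b`.
With `B` and `X` complete this is a Banach `B`-bimodule. -/
structure BanachBimodule where
  left : B →L[𝕜] X →L[𝕜] X
  right : B →L[𝕜] X →L[𝕜] X
  left_mul : ∀ a b x, left (a * b) x = left a (left b x)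
  right_mul : ∀ a b x, right (a * b) x = right b (right a x)
  left_right : ∀ a b x, left a (right b x) = right b (left a x)

/-- The algebra `B` as a bimodule over itself. -/
noncomputable def BanachBimodule.regular [IsScalarTower 𝕜 B B] [SMulCommClass 𝕜 B B] :
    BanachBimodule 𝕜 B B where
  left := ContinuousLinearMap.mul 𝕜 B
  right := (ContinuousLinearMap.mul 𝕜 B).flip
  left_mul a b x := by simp [mul_assoc]
  right_mul a b x := by simp [mul_assoc]
  left_right a b x := by simp [mul_assoc]

namespace BanachBimodule

variable {𝕜 B X}

/-- The dual bimodule `X*`: `(b · f)(x) = f (x · b)` and `(f · b)(x) = f (b · x)`. -/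
noncomputable def dual (M : BanachBimodule 𝕜 B X) : BanachBimodule 𝕜 B (StrongDual 𝕜 X) where
  left := (ContinuousLinearMap.compL 𝕜 X X 𝕜).flip ∘L M.right
  right := (ContinuousLinearMap.compL 𝕜 X X 𝕜).flip ∘L M.left
  left_mul a b f := by ext x; simp [M.right_mul]
  right_mul a b f := by ext x; simp [M.left_mul]
  left_right a b f := by ext x; simp [M.left_right]

theorem dual_left_apply (M : BanachBimodule 𝕜 B X) (b : B) (f : StrongDual 𝕜 X) (x : X) :
    M.dual.left b f x = f (M.right b x) := rfl

theorem dual_right_apply (M : BanachBimodule 𝕜 B X) (b : B) (f : StrongDual 𝕜 X) (x : X) :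
    M.dual.right b f x = f (M.left b x) := rfl

/-- `X = X B`: every element of `X` is a product `y · b`. -/
def FactorsLeft (M : BanachBimodule 𝕜 B X) : Prop :=
  ∀ x : X, ∃ (y : X) (b : B), x = M.right b y

/-- `X = B X`: every element of `X` is a product `b · y`. -/
def FactorsRight (M : BanachBimodule 𝕜 B X) : Prop :=
  ∀ x : X, ∃ (b : B) (y : X), x = M.left b y

/-- The bounded linear map `D : B → X` is a derivation: `D (a b) = a · D b + D a · b`. -/
def IsDerivation (M : BanachBimodule 𝕜 B X) (D : B →L[𝕜] X) : Prop :=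
  ∀ a b : B, D (a * b) = M.left a (D b) + M.right b (D a)

/-- `D` is inner: `D a = a · x - x · a` for some fixed `x`. -/
def IsInner (M : BanachBimodule 𝕜 B X) (D : B →L[𝕜] X) : Prop :=
  ∃ x : X, ∀ a : B, D a = M.left a x - M.right a x

end BanachBimodule

/-- Amenability: for every Banach `B`-bimodule `X`, every bounded derivation from `B` into the
dual bimodule `X*` is inner. -/
def IsAmenable : Prop :=
  ∀ (X : Type u) [NormedAddCommGroup X] [NormedSpace 𝕜 X] [CompleteSpace X]
    (M : BanachBimodule 𝕜 B X) (D : B →L[𝕜] StrongDual 𝕜 X),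
    M.dual.IsDerivation D → M.dual.IsInner D

end Bimodules

section DualAlgebras

variable {𝕜 : Type} [RCLike 𝕜]
variable {B : Type u} [NonUnitalNormedRing B] [NormedSpace 𝕜 B]
variable {P : Type u} [NormedAddCommGroup P] [NormedSpace 𝕜 P]

/-- The weak* topology on `B` coming from an identification `B = P*`. -/
@[reducible] noncomputable def weakStarTopology (ι : B ≃ₗᵢ[𝕜] StrongDual 𝕜 P) : TopologicalSpace B :=
  TopologicalSpace.induced (fun b => StrongDual.toWeakDual (ι b)) inferInstance

/-- Weak*-weak* continuity of a map from `B = P*` into a dual space `X*`. -/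
def IsWeakStarContinuous (ι : B ≃ₗᵢ[𝕜] StrongDual 𝕜 P)
    {X : Type u} [NormedAddCommGroup X] [NormedSpace 𝕜 X] (f : B → StrongDual 𝕜 X) : Prop :=
  @Continuous B (WeakDual 𝕜 X) (weakStarTopology ι) inferInstance
    (fun b => StrongDual.toWeakDual (f b))

/-- `B = P*` is a dual Banach algebra with predual `P`: regarded as a subspace of `B*` (each `p`
is the functional `c ↦ ι c p`), the predual `P` is a sub-bimodule of `B*`. -/
def IsDualBanachAlgebra (ι : B ≃ₗᵢ[𝕜] StrongDual 𝕜 P) : Prop :=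
  (∀ (b : B) (p : P), ∃ q : P, ∀ c : B, ι (c * b) p = ι c q) ∧
  (∀ (b : B) (p : P), ∃ q : P, ∀ c : B, ι (b * c) p = ι c q)

/-- The dual bimodule `X*` is normal: for every `f ∈ X*` the orbit maps `b ↦ b · f` and
`b ↦ f · b` are weak*-weak* continuous. -/
def BanachBimodule.DualIsNormal (ι : B ≃ₗᵢ[𝕜] StrongDual 𝕜 P)
    {X : Type u} [NormedAddCommGroup X] [NormedSpace 𝕜 X] (M : BanachBimodule 𝕜 B X) : Prop :=
  ∀ f : StrongDual 𝕜 X,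
    IsWeakStarContinuous ι (fun b => M.dual.left b f) ∧
    IsWeakStarContinuous ι (fun b => M.dual.right b f)

/-- Connes-amenability of the dual Banach algebra `B = P*`: every weak*-continuous bounded
derivation from `B` into a normal dual Banach `B`-bimodule is inner. (A dual Banach bimodule is,
up to identification, the dual bimodule `X*` of a Banach bimodule `X`, its predual.) -/
def IsConnesAmenable (ι : B ≃ₗᵢ[𝕜] StrongDual 𝕜 P) : Prop :=
  ∀ (X : Type u) [NormedAddCommGroup X] [NormedSpace 𝕜 X] [CompleteSpace X]
    (M : BanachBimodule 𝕜 B X), M.DualIsNormal ι →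
    ∀ D : B →L[𝕜] StrongDual 𝕜 X,
      M.dual.IsDerivation D → IsWeakStarContinuous ι D → M.dual.IsInner D

/-- The variant of Connes-amenability in which all dual Banach bimodules are allowed, normal or
not: every weak*-continuous bounded derivation from `B` into a dual Banach `B`-bimodule is
inner. -/
def IsConnesAmenableAllDual (ι : B ≃ₗᵢ[𝕜] StrongDual 𝕜 P) : Prop :=
  ∀ (X : Type u) [NormedAddCommGroup X] [NormedSpace 𝕜 X] [CompleteSpace X]
    (M : BanachBimodule 𝕜 B X) (D : B →L[𝕜] StrongDual 𝕜 X),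
      M.dual.IsDerivation D → IsWeakStarContinuous ι D → M.dual.IsInner D

end DualAlgebras

section SecondDual

variable (𝕜 : Type) [RCLike 𝕜]
variable (A : Type u) [NonUnitalNormedRing A] [NormedSpace 𝕜 A]

/-- The second dual `A**` of `A`; below it is made a Banach algebra by the first Arens product. -/
abbrev SecondDual : Type u := StrongDual 𝕜 (StrongDual 𝕜 A)

namespace SecondDual

/-- The canonical embedding `A → A**`, `a ↦ (f ↦ f a)`. -/
noncomputable abbrev embed (a : A) : SecondDual 𝕜 A :=
  NormedSpace.inclusionInDoubleDual 𝕜 A a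

variable [IsScalarTower 𝕜 A A] [SMulCommClass 𝕜 A A]

variable {𝕜 A}

/-- `f · a ∈ A*` for `f ∈ A*` and `a ∈ A`: `⟨f · a, b⟩ = ⟨f, a b⟩`. -/
noncomputable def dualMul (f : StrongDual 𝕜 A) : A →L[𝕜] StrongDual 𝕜 A :=
  (ContinuousLinearMap.compL 𝕜 A A 𝕜 f) ∘L (ContinuousLinearMap.mul 𝕜 A)

theorem dualMul_apply (f : StrongDual 𝕜 A) (a b : A) : dualMul f a b = f (a * b) := rfl

/-- `n · f ∈ A*` for `n ∈ A**` and `f ∈ A*`: `⟨n · f, a⟩ = ⟨n, f · a⟩`. -/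
noncomputable def bidualMul (n : SecondDual 𝕜 A) (f : StrongDual 𝕜 A) : StrongDual 𝕜 A :=
  n ∘L dualMul f

theorem bidualMul_apply (n : SecondDual 𝕜 A) (f : StrongDual 𝕜 A) (a : A) :
    bidualMul n f a = n (dualMul f a) := rfl

theorem norm_bidualMul_le (n : SecondDual 𝕜 A) (f : StrongDual 𝕜 A) :
    ‖bidualMul n f‖ ≤ ‖n‖ * ‖f‖ := by
  refine ContinuousLinearMap.opNorm_le_bound _ (by positivity) fun a => ?_
  have h1 : ‖dualMul f a‖ ≤ ‖f‖ * ‖a‖ :=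
    ContinuousLinearMap.opNorm_le_bound _ (by positivity) fun b => by
      rw [dualMul_apply, mul_assoc]
      exact (f.le_opNorm _).trans (by gcongr; exact norm_mul_le a b)
  rw [bidualMul_apply, mul_assoc]
  exact (n.le_opNorm (dualMul f a)).trans (by gcongr)

theorem bidualMul_add (n : SecondDual 𝕜 A) (f g : StrongDual 𝕜 A) :
    bidualMul n (f + g) = bidualMul n f + bidualMul n g := by
  ext a
  have : dualMul (f + g) a = dualMul f a + dualMul g a := by ext b; simp [dualMul_apply]
  simp [bidualMul_apply, this]

theorem bidualMul_smul (n : SecondDual 𝕜 A) (c : 𝕜) (f : StrongDual 𝕜 A) :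
    bidualMul n (c • f) = c • bidualMul n f := by
  ext a
  have : dualMul (c • f) a = c • dualMul f a := by ext b; simp [dualMul_apply]
  simp [bidualMul_apply, this]

/-- The first Arens product on `A**`: `⟨m n, f⟩ = ⟨m, n · f⟩`. -/
noncomputable def arensMul (m n : SecondDual 𝕜 A) : SecondDual 𝕜 A :=
  LinearMap.mkContinuous
    { toFun := fun f => m (bidualMul n f)
      map_add' := fun f g => by rw [bidualMul_add, map_add]
      map_smul' := fun c f => by rw [bidualMul_smul, map_smul]; rfl }
    (‖m‖ * ‖n‖) fun f => by
      rw [mul_assoc]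
      exact (m.le_opNorm (bidualMul n f)).trans
        (mul_le_mul_of_nonneg_left (norm_bidualMul_le n f) (norm_nonneg _))

theorem arensMul_apply (m n : SecondDual 𝕜 A) (f : StrongDual 𝕜 A) :
    arensMul m n f = m (bidualMul n f) := rfl

theorem norm_arensMul_le (m n : SecondDual 𝕜 A) : ‖arensMul m n‖ ≤ ‖m‖ * ‖n‖ :=
  LinearMap.mkContinuous_norm_le _ (by positivity) (fun f => by
    rw [mul_assoc]
    exact (m.le_opNorm (bidualMul n f)).trans
      (mul_le_mul_of_nonneg_left (norm_bidualMul_le n f) (norm_nonneg _)))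

theorem bidualMul_arensMul (m n : SecondDual 𝕜 A) (f : StrongDual 𝕜 A) :
    bidualMul (arensMul m n) f = bidualMul m (bidualMul n f) := by
  ext a
  rw [bidualMul_apply, bidualMul_apply, arensMul_apply]
  congr 1
  ext b
  rw [bidualMul_apply, dualMul_apply, bidualMul_apply]
  congr 1
  ext c
  simp [dualMul_apply, mul_assoc]

theorem add_bidualMul (m n : SecondDual 𝕜 A) (f : StrongDual 𝕜 A) :
    bidualMul (m + n) f = bidualMul m f + bidualMul n f := by
  ext a; simp [bidualMul_apply]

/-- `A**` with the first Arens product is a Banach algebra (for its usual norm). -/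
noncomputable instance instNonUnitalNormedRing : NonUnitalNormedRing (SecondDual 𝕜 A) where
  __ := (ContinuousLinearMap.toNormedAddCommGroup : NormedAddCommGroup (SecondDual 𝕜 A))
  mul := arensMul
  left_distrib a b c := ContinuousLinearMap.ext fun f => by
    change a (bidualMul (b + c) f) = a (bidualMul b f) + a (bidualMul c f)
    rw [add_bidualMul, map_add]
  right_distrib a b c := rfl
  zero_mul a := rfl
  mul_zero a := ContinuousLinearMap.ext fun f => map_zero a
  mul_assoc a b c := ContinuousLinearMap.ext fun f => by
    change a (bidualMul b (bidualMul c f)) = a (bidualMul (arensMul b c) f)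
    rw [bidualMul_arensMul]
  norm_mul_le m n := norm_arensMul_le m n

theorem mul_apply (m n : SecondDual 𝕜 A) (f : StrongDual 𝕜 A) :
    (m * n) f = m (bidualMul n f) := rfl

instance : IsScalarTower 𝕜 (SecondDual 𝕜 A) (SecondDual 𝕜 A) :=
  ⟨fun _ _ _ => rfl⟩

instance : SMulCommClass 𝕜 (SecondDual 𝕜 A) (SecondDual 𝕜 A) :=
  ⟨fun c m n => ContinuousLinearMap.ext fun f => (map_smul m c (bidualMul n f)).symm⟩

variable (𝕜 A)

/-- The identification of the Banach algebra `A**` with the dual of `A*` (the identity map), which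
makes `A*` the predual of `A**`. -/
noncomputable def predualIso : SecondDual 𝕜 A ≃ₗᵢ[𝕜] StrongDual 𝕜 (StrongDual 𝕜 A) :=
  LinearIsometryEquiv.refl 𝕜 (StrongDual 𝕜 (StrongDual 𝕜 A))

/-- The canonical image of `A` is a two-sided ideal in `A**`. -/
def IsIdealInSecondDual : Prop :=
  ∀ (a : A) (m : SecondDual 𝕜 A),
    (∃ c : A, embed 𝕜 A a * m = embed 𝕜 A c) ∧ (∃ c : A, m * embed 𝕜 A a = embed 𝕜 A c)

end SecondDual

end SecondDual

/-!
The argument avoids nets and Cohen factorization: a limit along a bounded approximate identity is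
replaced throughout by evaluation at a mixed identity `E ∈ A**`.

*Regularity.* `A` is an ideal in `A**` exactly when the multiplications `b ↦ a b` and `b ↦ b a` are
weakly compact. Two functionals of the biduals can be interchanged on a bilinear form that factors
through a weakly compact operator (`interchange_of_mem_weaklyCompactOperators`). If `A*` factors on
one side, every `f ∈ A*` gives such a form `(b, c) ↦ ⟨f, b c⟩`, so `A` is Arens regular
(`isArensRegular_of_factors`), and multiplication in `A**` is weak*-continuous in each variable.
Either amenability hypothesis, applied to a module with one action zero, gives one-sided identities,
and by regularity these form a single identity `E` of `A**`.

*From `A` to `A**`.* Let `D` be a weak*-continuous derivation from `A**` into `X*`, implemented on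
`A` by `φ`. The module need not be normal, but since `A` is an ideal, averaging `φ` over `E` on
either side gives `P` and `Q` with `D m = m · P - Q · m`. The derivation identity then forces
`E · (P - Q) · E = 0`, and `P + Q - P · E` implements `D` (`isInner_of_isInner_on_algebra`).

*From `A**` to `A`.* Let `D` be a derivation from `A` into `X*`, and `Y` the closed span of `A X A`.
The orbit maps of `Y` are weakly compact, so both actions extend to `A**` with normal dual `Y*`
(`BanachBimodule.HasWeaklyCompactOrbits.extension`), and `D` followed by restriction to `Y` extends
to a weak*-continuous derivation, which is inner by assumption. After subtracting an inner
derivation `D` vanishes on `Y`, and such a derivation is inner by an explicit formula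
(`BanachBimodule.isInner_of_vanishing_on_essentialPart`).
-/

/-! ### Weakly compact operators -/

section WeaklyCompact

variable {𝕜 : Type} [RCLike 𝕜]
variable {V W Z : Type u} [NormedAddCommGroup V] [NormedSpace 𝕜 V]
  [NormedAddCommGroup W] [NormedSpace 𝕜 W] [NormedAddCommGroup Z] [NormedSpace 𝕜 Z]

variable (𝕜 V W) in
/-- The weakly compact operators, in Gantmacher's form: those `L : V → W` whose second adjoint
`L** : V** → W**` takes its values in the canonical image of `W`. -/
noncomputable def weaklyCompactOperators : Submodule 𝕜 (V →L[𝕜] W) :=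
  ⨅ m : StrongDual 𝕜 (StrongDual 𝕜 V),
    (LinearMap.range (NormedSpace.inclusionInDoubleDual 𝕜 W).toLinearMap).comap
      ((ContinuousLinearMap.compL 𝕜 (StrongDual 𝕜 W) (StrongDual 𝕜 V) 𝕜 m) ∘L
        (ContinuousLinearMap.compL 𝕜 V W 𝕜).flip).toLinearMap

theorem mem_weaklyCompactOperators {L : V →L[𝕜] W} :
    L ∈ weaklyCompactOperators 𝕜 V W ↔ ∀ m : StrongDual 𝕜 (StrongDual 𝕜 V),
      ∃ w : W, ∀ f : StrongDual 𝕜 W, m (f ∘L L) = f w := by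
  simp only [weaklyCompactOperators, Submodule.mem_iInf, Submodule.mem_comap, LinearMap.mem_range]
  refine forall_congr' fun m => exists_congr fun w => ?_
  rw [eq_comm, ContinuousLinearMap.ext_iff]
  rfl

theorem isClosed_weaklyCompactOperators [CompleteSpace W] :
    IsClosed (weaklyCompactOperators 𝕜 V W : Set (V →L[𝕜] W)) := by
  have hi : Isometry (NormedSpace.inclusionInDoubleDual 𝕜 W) :=
    (NormedSpace.inclusionInDoubleDualLi (E := W) 𝕜).isometry
  have hr := hi.isClosedEmbedding.isClosed_range
  rw [weaklyCompactOperators, Submodule.coe_iInf]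
  exact isClosed_iInter fun m => hr.preimage (ContinuousLinearMap.continuous _)

theorem comp_mem_weaklyCompactOperators {L : V →L[𝕜] W} (hL : L ∈ weaklyCompactOperators 𝕜 V W)
    (T : W →L[𝕜] Z) : T ∘L L ∈ weaklyCompactOperators 𝕜 V Z := by
  rw [mem_weaklyCompactOperators] at hL ⊢
  intro m
  obtain ⟨w, hw⟩ := hL m
  exact ⟨T w, fun f => hw (f ∘L T)⟩

/-- Grothendieck's iterated-limit principle: two functionals in the biduals may be applied in
either order to a bilinear form which factors through a weakly compact operator in one variable. -/
theorem interchange_of_mem_weaklyCompactOperators {L : V →L[𝕜] W}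
    (hL : L ∈ weaklyCompactOperators 𝕜 V W) (T : W →L[𝕜] StrongDual 𝕜 Z)
    (m : StrongDual 𝕜 (StrongDual 𝕜 V)) (n : StrongDual 𝕜 (StrongDual 𝕜 Z)) :
    m (n ∘L (T ∘L L)) = n (m ∘L (T ∘L L).flip) := by
  obtain ⟨w, hw⟩ := mem_weaklyCompactOperators.1 hL m
  have h : m ∘L (T ∘L L).flip = T w := by
    ext z
    exact hw (T.flip z)
  rw [h]
  exact hw (n ∘L T)

end WeaklyCompact

section BidualExtension

variable {𝕜 : Type} [RCLike 𝕜]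
variable {V W Z : Type u} [NormedAddCommGroup V] [NormedSpace 𝕜 V]
  [NormedAddCommGroup W] [NormedSpace 𝕜 W] [NormedAddCommGroup Z] [NormedSpace 𝕜 Z]

/-- The Arens adjoint of a bounded bilinear map `T : W × V → Z`: the bounded bilinear map
`Z* × W → V*`, `(n, w) ↦ n ∘ T w`. -/
noncomputable def arensAdjoint (T : W →L[𝕜] V →L[𝕜] Z) :
    StrongDual 𝕜 Z →L[𝕜] W →L[𝕜] StrongDual 𝕜 V :=
  (ContinuousLinearMap.compL 𝕜 W (V →L[𝕜] Z) (V →L[𝕜] 𝕜)).flip T ∘L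
    ContinuousLinearMap.compL 𝕜 V Z 𝕜

end BidualExtension

/-! ### Weak*-continuity on the second dual -/

section WeakStar

variable {𝕜 : Type} [RCLike 𝕜]
variable {A : Type u} [NonUnitalNormedRing A] [NormedSpace 𝕜 A]
  [IsScalarTower 𝕜 A A] [SMulCommClass 𝕜 A A]
variable {X : Type u} [NormedAddCommGroup X] [NormedSpace 𝕜 X]

theorem isWeakStarContinuous_of_forall_exists {F : SecondDual 𝕜 A → StrongDual 𝕜 X}
    (h : ∀ x, ∃ f : StrongDual 𝕜 A, ∀ m, F m x = m f) :
    IsWeakStarContinuous (𝕜 := 𝕜) (B := SecondDual 𝕜 A) (P := StrongDual 𝕜 A)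
      (SecondDual.predualIso 𝕜 A) F := by
  let τ : TopologicalSpace (SecondDual 𝕜 A) :=
    weakStarTopology (𝕜 := 𝕜) (B := SecondDual 𝕜 A) (P := StrongDual 𝕜 A)
      (SecondDual.predualIso 𝕜 A)
  refine WeakDual.continuous_of_continuous_eval (α := SecondDual 𝕜 A) fun x => ?_
  obtain ⟨f, hf⟩ := h x
  have h1 : @Continuous (SecondDual 𝕜 A) 𝕜 τ _ fun m =>
      (StrongDual.toWeakDual (SecondDual.predualIso 𝕜 A m)) f :=
    (WeakDual.eval_continuous f).comp continuous_induced_dom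
  have h2 : (fun m => F m x) = fun m : SecondDual 𝕜 A =>
      (StrongDual.toWeakDual (SecondDual.predualIso 𝕜 A m)) f := funext hf
  exact h2 ▸ h1

/-- A weak*-continuous linear map `A** → X*` is, pointwise on `X`, evaluation at an element of
the predual `A*`. -/
theorem exists_predual_of_isWeakStarContinuous {F : SecondDual 𝕜 A →L[𝕜] StrongDual 𝕜 X}
    (h : IsWeakStarContinuous (𝕜 := 𝕜) (B := SecondDual 𝕜 A) (P := StrongDual 𝕜 A)
      (SecondDual.predualIso 𝕜 A) F) (x : X) :
    ∃ f : StrongDual 𝕜 A, ∀ m, F m x = m f := by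
  let φ : WeakDual 𝕜 (StrongDual 𝕜 A) →ₗ[𝕜] 𝕜 :=
    { toFun := fun m => F (WeakDual.toStrongDual m) x
      map_add' := fun m n => by rw [map_add, map_add]; rfl
      map_smul' := fun c m => by rw [map_smul, map_smul]; rfl }
  let τ : TopologicalSpace (SecondDual 𝕜 A) :=
    weakStarTopology (𝕜 := 𝕜) (B := SecondDual 𝕜 A) (P := StrongDual 𝕜 A)
      (SecondDual.predualIso 𝕜 A)
  have h1 : @Continuous (SecondDual 𝕜 A) 𝕜 τ _ fun m => F m x :=
    (WeakDual.eval_continuous x).comp h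
  have h2 : @Continuous (WeakDual 𝕜 (StrongDual 𝕜 A)) (SecondDual 𝕜 A) _ τ
      (fun m => WeakDual.toStrongDual m) :=
    continuous_induced_rng.2 continuous_id
  have hφ : Continuous φ := @Continuous.comp _ _ _ _ τ _ _ _ h1 h2
  obtain ⟨f, hf⟩ := LinearMap.dualEmbedding_surjective _
    (⟨φ, hφ⟩ : StrongDual 𝕜 (WeakDual 𝕜 (StrongDual 𝕜 A)))
  exact ⟨f, fun m => (DFunLike.congr_fun hf (StrongDual.toWeakDual m)).symm⟩

end WeakStar

/-! ### Arens regularity -/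

section Arens

open SecondDual

variable {𝕜 : Type} [RCLike 𝕜]
variable {A : Type u} [NonUnitalNormedRing A] [NormedSpace 𝕜 A]
  [IsScalarTower 𝕜 A A] [SMulCommClass 𝕜 A A]

theorem mulLeft_mem_weaklyCompactOperators (hideal : IsIdealInSecondDual 𝕜 A) (a : A) :
    ContinuousLinearMap.mul 𝕜 A a ∈ weaklyCompactOperators 𝕜 A A := by
  rw [mem_weaklyCompactOperators]
  intro m
  obtain ⟨c, hc⟩ := (hideal a m).1
  exact ⟨c, fun f => DFunLike.congr_fun hc f⟩

theorem mulRight_mem_weaklyCompactOperators (hideal : IsIdealInSecondDual 𝕜 A) (a : A) :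
    (ContinuousLinearMap.mul 𝕜 A).flip a ∈ weaklyCompactOperators 𝕜 A A := by
  rw [mem_weaklyCompactOperators]
  intro m
  obtain ⟨c, hc⟩ := (hideal a m).2
  exact ⟨c, fun f => DFunLike.congr_fun hc f⟩

variable (𝕜 A) in
/-- Arens regularity: the first Arens product (left-hand side) and the second Arens product
(right-hand side) of `m` and `n` coincide. -/
def IsArensRegular : Prop :=
  ∀ (m n : SecondDual 𝕜 A) (f : StrongDual 𝕜 A),
    m (n ∘L dualMul f) = n (m ∘L (dualMul f).flip)

theorem isArensRegular_of_factors (hideal : IsIdealInSecondDual 𝕜 A)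
    (hfactors : (BanachBimodule.regular 𝕜 A).dual.FactorsLeft ∨
      (BanachBimodule.regular 𝕜 A).dual.FactorsRight) :
    IsArensRegular 𝕜 A := by
  intro m n f
  rcases hfactors with h | h
  · obtain ⟨g, a, rfl⟩ := h f
    -- `⟨g · a, b c⟩ = ⟨g, (a b) c⟩`, and `b ↦ a b` is weakly compact
    have key := interchange_of_mem_weaklyCompactOperators
      (mulLeft_mem_weaklyCompactOperators hideal a) (dualMul g) m n
    have e : dualMul ((BanachBimodule.regular 𝕜 A).dual.right a g)
        = dualMul g ∘L ContinuousLinearMap.mul 𝕜 A a := by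
      ext b c
      exact congrArg g (mul_assoc a b c).symm
    rw [e, key]
  · obtain ⟨a, g, rfl⟩ := h f
    -- `⟨a · g, b c⟩ = ⟨g, b (c a)⟩`, and `c ↦ c a` is weakly compact
    have key := interchange_of_mem_weaklyCompactOperators
      (mulRight_mem_weaklyCompactOperators hideal a) (dualMul g).flip n m
    have e : (dualMul ((BanachBimodule.regular 𝕜 A).dual.left a g)).flip
        = (dualMul g).flip ∘L (ContinuousLinearMap.mul 𝕜 A).flip a := by
      ext c b
      exact congrArg g (mul_assoc b c a)
    rw [e, key, ← e, ContinuousLinearMap.flip_flip]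

theorem IsArensRegular.isDualBanachAlgebra (hreg : IsArensRegular 𝕜 A) :
    IsDualBanachAlgebra (𝕜 := 𝕜) (B := SecondDual 𝕜 A) (P := StrongDual 𝕜 A)
      (predualIso 𝕜 A) :=
  ⟨fun b f => ⟨b ∘L dualMul f, fun _ => rfl⟩,
    fun b f => ⟨b ∘L (dualMul f).flip, fun c => hreg b c f⟩⟩

variable (𝕜 A) in
/-- `E ∈ A**` is a mixed identity: `a E = a = E a` for all `a ∈ A`. -/
def IsMixedIdentity (E : SecondDual 𝕜 A) : Prop :=
  (∀ a : A, embed 𝕜 A a * E = embed 𝕜 A a) ∧ ∀ a : A, E * embed 𝕜 A a = embed 𝕜 A a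

theorem mul_eq_self_of_embed_mul_eq {E : SecondDual 𝕜 A}
    (h : ∀ a : A, embed 𝕜 A a * E = embed 𝕜 A a) (m : SecondDual 𝕜 A) : m * E = m := by
  ext f
  have : bidualMul E f = f := by
    ext a
    exact DFunLike.congr_fun (h a) f
  rw [mul_apply, this]

theorem IsArensRegular.mul_eq_self_of_mul_embed_eq (hreg : IsArensRegular 𝕜 A)
    {E : SecondDual 𝕜 A} (h : ∀ a : A, E * embed 𝕜 A a = embed 𝕜 A a) (m : SecondDual 𝕜 A) :
    E * m = m := by
  ext f
  have : E ∘L (dualMul f).flip = f := by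
    ext a
    exact DFunLike.congr_fun (h a) f
  exact (hreg E m f).trans (by rw [this])

/-- A one-sided identity of `A` on each side gives a mixed identity: by regularity the two extend
to one-sided identities of `A**`, and so they agree. -/
theorem IsArensRegular.exists_isMixedIdentity (hreg : IsArensRegular 𝕜 A)
    (hr : ∃ E : SecondDual 𝕜 A, ∀ a : A, embed 𝕜 A a * E = embed 𝕜 A a)
    (hl : ∃ E : SecondDual 𝕜 A, ∀ a : A, E * embed 𝕜 A a = embed 𝕜 A a) :
    ∃ E, IsMixedIdentity 𝕜 A E := by
  obtain ⟨E, hE⟩ := hr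
  obtain ⟨F, hF⟩ := hl
  have h : E = F :=
    (hreg.mul_eq_self_of_mul_embed_eq hF E).symm.trans (mul_eq_self_of_embed_mul_eq hE F)
  exact ⟨E, hE, h ▸ hF⟩

end Arens

/-! ### Existence of a mixed identity -/

namespace BanachBimodule

variable {𝕜 : Type} [RCLike 𝕜]
variable {B : Type u} [NonUnitalNormedRing B] [NormedSpace 𝕜 B]
variable {X : Type u} [NormedAddCommGroup X] [NormedSpace 𝕜 X]

/-- The bimodule with the given left action and zero right action. -/
def ofLeft (l : B →L[𝕜] X →L[𝕜] X) (h : ∀ a b x, l (a * b) x = l a (l b x)) :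
    BanachBimodule 𝕜 B X where
  left := l
  right := 0
  left_mul := h
  right_mul _ _ _ := by simp
  left_right _ _ _ := by simp

/-- The bimodule with the given right action and zero left action. -/
def ofRight (r : B →L[𝕜] X →L[𝕜] X) (h : ∀ a b x, r (a * b) x = r b (r a x)) :
    BanachBimodule 𝕜 B X where
  left := 0
  right := r
  left_mul _ _ _ := by simp
  right_mul := h
  left_right _ _ _ := by simp

end BanachBimodule

section MixedIdentity

open SecondDual

variable {𝕜 : Type} [RCLike 𝕜]
variable {A : Type u} [NonUnitalNormedRing A] [NormedSpace 𝕜 A]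
  [IsScalarTower 𝕜 A A] [SMulCommClass 𝕜 A A]

/-- The canonical embedding `A → A**` is a derivation when one of the two actions of `A` on `A**`
is replaced by zero; implementing it amounts to giving a one-sided identity. -/
theorem IsAmenable.exists_isMixedIdentity (hreg : IsArensRegular 𝕜 A) (h : IsAmenable 𝕜 A) :
    ∃ E, IsMixedIdentity 𝕜 A E := by
  let R := (BanachBimodule.regular 𝕜 A).dual
  refine hreg.exists_isMixedIdentity ?_ ?_
  · let M := BanachBimodule.ofRight R.right R.right_mul
    have hr (a : A) (n : SecondDual 𝕜 A) : M.dual.right a n = 0 :=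
      ContinuousLinearMap.ext fun f => map_zero n
    obtain ⟨E, hE⟩ := h (StrongDual 𝕜 A) M (NormedSpace.inclusionInDoubleDual 𝕜 A)
      fun a b => by rw [hr, add_zero]; rfl
    refine ⟨E, fun a => ?_⟩
    have := hE a
    rw [hr, sub_zero] at this
    exact this.symm
  · let M := BanachBimodule.ofLeft R.left R.left_mul
    have hl (a : A) (n : SecondDual 𝕜 A) : M.dual.left a n = 0 :=
      ContinuousLinearMap.ext fun f => map_zero n
    obtain ⟨E, hE⟩ := h (StrongDual 𝕜 A) M (NormedSpace.inclusionInDoubleDual 𝕜 A)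
      fun a b => by rw [hl, zero_add]; rfl
    refine ⟨-E, fun a => ?_⟩
    have := hE a
    rw [hl, zero_sub] at this
    rw [neg_mul]
    exact this.symm

variable (𝕜 A) in
/-- The left action `(n, f) ↦ n · f` of `A**` on its predual `A*`, for `⟨n · f, a⟩ = ⟨n, f · a⟩`. -/
noncomputable def predualLeft : SecondDual 𝕜 A →L[𝕜] StrongDual 𝕜 A →L[𝕜] StrongDual 𝕜 A :=
  arensAdjoint (BanachBimodule.regular 𝕜 A).dual.right.flip

variable (𝕜 A) in
/-- The right action `(f, n) ↦ f · n` of `A**` on its predual `A*`, for `⟨f · n, a⟩ = ⟨n, a · f⟩`. -/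
noncomputable def predualRight : SecondDual 𝕜 A →L[𝕜] StrongDual 𝕜 A →L[𝕜] StrongDual 𝕜 A :=
  arensAdjoint (BanachBimodule.regular 𝕜 A).dual.left.flip

theorem IsArensRegular.apply_predualRight (hreg : IsArensRegular 𝕜 A) (m n : SecondDual 𝕜 A)
    (f : StrongDual 𝕜 A) : n (predualRight 𝕜 A m f) = (m * n) f := (hreg m n f).symm

theorem IsArensRegular.predualRight_mul (hreg : IsArensRegular 𝕜 A) (m n : SecondDual 𝕜 A)
    (f : StrongDual 𝕜 A) :
    predualRight 𝕜 A (m * n) f = predualRight 𝕜 A n (predualRight 𝕜 A m f) := by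
  ext a
  change embed 𝕜 A a (predualRight 𝕜 A (m * n) f) =
    embed 𝕜 A a (predualRight 𝕜 A n (predualRight 𝕜 A m f))
  rw [hreg.apply_predualRight, hreg.apply_predualRight, hreg.apply_predualRight, mul_assoc]

/-- The identity map of `A**` is a weak*-continuous derivation into the normal bimodule `A**` with
one of the two actions replaced by zero. -/
theorem IsConnesAmenable.exists_isMixedIdentity (hreg : IsArensRegular 𝕜 A)
    (h : IsConnesAmenable (𝕜 := 𝕜) (B := SecondDual 𝕜 A) (P := StrongDual 𝕜 A)
      (predualIso 𝕜 A)) :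
    ∃ E, IsMixedIdentity 𝕜 A E := by
  have hid : IsWeakStarContinuous (𝕜 := 𝕜) (B := SecondDual 𝕜 A) (P := StrongDual 𝕜 A)
      (predualIso 𝕜 A) (ContinuousLinearMap.id 𝕜 (SecondDual 𝕜 A)) :=
    isWeakStarContinuous_of_forall_exists fun f => ⟨f, fun _ => rfl⟩
  have hzero : IsWeakStarContinuous (𝕜 := 𝕜) (B := SecondDual 𝕜 A) (P := StrongDual 𝕜 A)
      (predualIso 𝕜 A) (fun _ => (0 : SecondDual 𝕜 A)) :=
    isWeakStarContinuous_of_forall_exists fun f => ⟨0, fun m => (map_zero m).symm⟩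
  refine hreg.exists_isMixedIdentity ?_ ?_
  · let M : BanachBimodule 𝕜 (SecondDual 𝕜 A) (StrongDual 𝕜 A) :=
      BanachBimodule.ofRight (predualRight 𝕜 A) hreg.predualRight_mul
    have hl (m n : SecondDual 𝕜 A) : M.dual.left m n = m * n :=
      ContinuousLinearMap.ext fun f => hreg.apply_predualRight m n f
    have hr (m n : SecondDual 𝕜 A) : M.dual.right m n = 0 :=
      ContinuousLinearMap.ext fun f => map_zero n
    obtain ⟨E, hE⟩ := h (StrongDual 𝕜 A) M
      (fun n => ⟨isWeakStarContinuous_of_forall_exists fun f =>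
        ⟨bidualMul n f, fun m => DFunLike.congr_fun (hl m n) f⟩, by simpa only [hr] using hzero⟩)
      (ContinuousLinearMap.id 𝕜 (SecondDual 𝕜 A)) (fun m n => by rw [hl, hr]; exact (add_zero _).symm)
      hid
    refine ⟨E, fun a => ?_⟩
    have := hE (embed 𝕜 A a)
    rw [hl, hr] at this
    exact (this.trans (sub_zero _)).symm
  · let M : BanachBimodule 𝕜 (SecondDual 𝕜 A) (StrongDual 𝕜 A) :=
      BanachBimodule.ofLeft (predualLeft 𝕜 A) bidualMul_arensMul
    have hl (m n : SecondDual 𝕜 A) : M.dual.left m n = 0 :=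
      ContinuousLinearMap.ext fun f => map_zero n
    have hr (m n : SecondDual 𝕜 A) : M.dual.right m n = n * m := rfl
    obtain ⟨E, hE⟩ := h (StrongDual 𝕜 A) M
      (fun n => ⟨by simpa only [hl] using hzero, isWeakStarContinuous_of_forall_exists fun f =>
        ⟨predualRight 𝕜 A n f, fun m => (hreg.apply_predualRight n m f).symm⟩⟩)
      (ContinuousLinearMap.id 𝕜 (SecondDual 𝕜 A)) (fun m n => by rw [hl, hr]; exact (zero_add _).symm)
      hid
    refine ⟨-E, fun a => ?_⟩
    have := hE (embed 𝕜 A a)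
    rw [hl, hr] at this
    rw [neg_mul]
    exact (this.trans (zero_sub _)).symm

end MixedIdentity

/-! ### From amenability of `A` to Connes-amenability of `A**` -/

section AmenableToConnes

open SecondDual

variable {𝕜 : Type} [RCLike 𝕜]
variable {A : Type u} [NonUnitalNormedRing A] [NormedSpace 𝕜 A]
  [IsScalarTower 𝕜 A A] [SMulCommClass 𝕜 A A]
variable {X : Type u} [NormedAddCommGroup X] [NormedSpace 𝕜 X]

/-- An `A**`-bimodule regarded as an `A`-bimodule. -/
noncomputable def BanachBimodule.restrictToAlgebra (M : BanachBimodule 𝕜 (SecondDual 𝕜 A) X) :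
    BanachBimodule 𝕜 A X where
  left := M.left ∘L NormedSpace.inclusionInDoubleDual 𝕜 A
  right := M.right ∘L NormedSpace.inclusionInDoubleDual 𝕜 A
  left_mul a b := M.left_mul (embed 𝕜 A a) (embed 𝕜 A b)
  right_mul a b := M.right_mul (embed 𝕜 A a) (embed 𝕜 A b)
  left_right a b := M.left_right (embed 𝕜 A a) (embed 𝕜 A b)

variable (M : BanachBimodule 𝕜 (SecondDual 𝕜 A) X) {E : SecondDual 𝕜 A} (φ : StrongDual 𝕜 X)

/-- The functional `a ↦ ⟨φ, x · a⟩` on `A`. For `a` running through a net converging weak* to `E`,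
`E (rightCoeff M φ x)` is the limit of `⟨φ, x · a⟩`. -/
noncomputable def rightCoeff : X →L[𝕜] StrongDual 𝕜 A :=
  (M.restrictToAlgebra.dual.left.flip φ).flip

/-- The functional `a ↦ ⟨φ, a · x⟩` on `A`. -/
noncomputable def leftCoeff : X →L[𝕜] StrongDual 𝕜 A :=
  (M.restrictToAlgebra.dual.right.flip φ).flip

theorem rightCoeff_apply (x : X) (a : A) :
    rightCoeff M φ x a = φ (M.right (embed 𝕜 A a) x) := rfl

theorem leftCoeff_apply (x : X) (a : A) :
    leftCoeff M φ x a = φ (M.left (embed 𝕜 A a) x) := rfl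

/-- The module `X` need not be normal, but averaging `φ` over the mixed identity makes its orbit
weak*-continuous, because `m a ∈ A` for `a ∈ A` and `m ∈ A**`. -/
theorem apply_rightCoeff_right (hideal : IsIdealInSecondDual 𝕜 A) (hreg : IsArensRegular 𝕜 A)
    (hE : IsMixedIdentity 𝕜 A E) (m : SecondDual 𝕜 A) (x : X) :
    E (rightCoeff M φ (M.right m x)) = m (rightCoeff M φ x) := by
  have h : rightCoeff M φ (M.right m x) = m ∘L (dualMul (rightCoeff M φ x)).flip := by
    ext a
    obtain ⟨c, hc⟩ := (hideal a m).2
    rw [rightCoeff_apply, ← M.right_mul, hc, ← rightCoeff_apply]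
    exact (DFunLike.congr_fun hc (rightCoeff M φ x)).symm
  rw [h, ← hreg]
  exact DFunLike.congr_fun (mul_eq_self_of_embed_mul_eq hE.1 m) _

theorem apply_leftCoeff_left (hideal : IsIdealInSecondDual 𝕜 A) (hreg : IsArensRegular 𝕜 A)
    (hE : IsMixedIdentity 𝕜 A E) (m : SecondDual 𝕜 A) (x : X) :
    E (leftCoeff M φ (M.left m x)) = m (leftCoeff M φ x) := by
  have h : leftCoeff M φ (M.left m x) = bidualMul m (leftCoeff M φ x) := by
    ext a
    obtain ⟨c, hc⟩ := (hideal a m).1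
    rw [leftCoeff_apply, ← M.left_mul, hc, ← leftCoeff_apply]
    exact (DFunLike.congr_fun hc (leftCoeff M φ x)).symm
  rw [h]
  exact DFunLike.congr_fun (hreg.mul_eq_self_of_mul_embed_eq hE.2 m) _

/-- If a weak*-continuous derivation `D` from `A**` is implemented on `A` by `φ`, and `P`, `Q` are
the averages of `φ` over the mixed identity `E` on either side, then `D m = m · P - Q · m`, and
`P + Q - P · E` implements `D`. -/
theorem isInner_of_isInner_on_algebra (hideal : IsIdealInSecondDual 𝕜 A)
    (hreg : IsArensRegular 𝕜 A) (hE : IsMixedIdentity 𝕜 A E)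
    (D : SecondDual 𝕜 A →L[𝕜] StrongDual 𝕜 X) (hD : M.dual.IsDerivation D)
    (hcont : IsWeakStarContinuous (𝕜 := 𝕜) (B := SecondDual 𝕜 A) (P := StrongDual 𝕜 A)
      (predualIso 𝕜 A) D)
    (hφ : ∀ a : A, D (embed 𝕜 A a) =
      M.dual.left (embed 𝕜 A a) φ - M.dual.right (embed 𝕜 A a) φ) :
    M.dual.IsInner D := by
  have hmE := mul_eq_self_of_embed_mul_eq hE.1
  have hEm := hreg.mul_eq_self_of_mul_embed_eq hE.2
  let P : StrongDual 𝕜 X := E ∘L rightCoeff M φ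
  let Q : StrongDual 𝕜 X := E ∘L leftCoeff M φ
  have hDPQ (m : SecondDual 𝕜 A) (x : X) : D m x = P (M.right m x) - Q (M.left m x) := by
    obtain ⟨f, hf⟩ := exists_predual_of_isWeakStarContinuous hcont x
    have : f = rightCoeff M φ x - leftCoeff M φ x := by
      ext a
      exact (hf (embed 𝕜 A a)).symm.trans (DFunLike.congr_fun (hφ a) x)
    rw [hf, this, map_sub]
    exact congrArg₂ _ (apply_rightCoeff_right M φ hideal hreg hE m x).symm
      (apply_leftCoeff_left M φ hideal hreg hE m x).symm
  have hP (x : X) : P (M.right E x) = P x := apply_rightCoeff_right M φ hideal hreg hE E x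
  have hQ (x : X) : Q (M.left E x) = Q x := apply_leftCoeff_left M φ hideal hreg hE E x
  -- the derivation identity at `E = E * E` says `E · (P - Q) · E = 0`
  have hPQ (x : X) : P (M.left E x) = Q (M.right E x) := by
    have h1 : D (E * E) x = D E (M.right E x) + D E (M.left E x) := by
      rw [hD E E]
      rfl
    rw [hmE, hDPQ, hDPQ, hDPQ, hP, hP, hP, hQ, M.left_right, hP, ← M.left_right, hQ, hQ, hQ] at h1
    linear_combination -h1
  refine ⟨P + Q - P ∘L M.left E, fun m => ContinuousLinearMap.ext fun x => ?_⟩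
  have h2 : P (M.left E (M.right m x)) = Q (M.right m x) := by
    rw [hPQ, ← M.right_mul, hmE]
  have h3 : P (M.left E (M.left m x)) = P (M.left m x) := by
    rw [← M.left_mul, hEm]
  have h4 : (M.dual.left m (P + Q - P ∘L M.left E) - M.dual.right m (P + Q - P ∘L M.left E)) x =
      (P (M.right m x) + Q (M.right m x) - P (M.left E (M.right m x))) -
        (P (M.left m x) + Q (M.left m x) - P (M.left E (M.left m x))) := rfl
  rw [h4, h2, h3, hDPQ]
  ring

theorem IsAmenable.isConnesAmenableAllDual (hideal : IsIdealInSecondDual 𝕜 A)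
    (hreg : IsArensRegular 𝕜 A) (h : IsAmenable 𝕜 A) :
    IsConnesAmenableAllDual (𝕜 := 𝕜) (B := SecondDual 𝕜 A) (P := StrongDual 𝕜 A)
      (predualIso 𝕜 A) := by
  intro X _ _ _ M D hD hcont
  obtain ⟨E, hE⟩ := h.exists_isMixedIdentity hreg
  obtain ⟨φ, hφ⟩ := h X M.restrictToAlgebra (D ∘L NormedSpace.inclusionInDoubleDual 𝕜 A)
    fun a b => hD (embed 𝕜 A a) (embed 𝕜 A b)
  exact isInner_of_isInner_on_algebra M φ hideal hreg hE D hD hcont hφ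

end AmenableToConnes

/-! ### Extending weakly compact actions to the second dual -/

section BilinearExtension

variable {𝕜 : Type} [RCLike 𝕜]
variable {V W Z : Type u} [NormedAddCommGroup V] [NormedSpace 𝕜 V]
  [NormedAddCommGroup W] [NormedSpace 𝕜 W] [NormedAddCommGroup Z] [NormedSpace 𝕜 Z]

/-- If all the operators `T w : V → Z` are weakly compact, the bilinear map `(v, w) ↦ T w v`
extends to `V** × W → Z` by `(m, w) ↦ (T w)** m`. -/
noncomputable def bidualExtension (T : W →L[𝕜] V →L[𝕜] Z)
    (hT : ∀ w, T w ∈ weaklyCompactOperators 𝕜 V Z) :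
    StrongDual 𝕜 (StrongDual 𝕜 V) →L[𝕜] W →L[𝕜] Z :=
  have h (m : StrongDual 𝕜 (StrongDual 𝕜 V)) (w : W) :=
    (mem_weaklyCompactOperators.1 (hT w) m).choose_spec
  LinearMap.mkContinuous₂
    (LinearMap.mk₂ 𝕜 (fun m w => (mem_weaklyCompactOperators.1 (hT w) m).choose)
      (fun m n w => (SeparatingDual.eq_iff_forall_dual_eq (R := 𝕜)).2 fun f => by
        rw [map_add f, ← h, ← h, ← h]; rfl)
      (fun c m w => (SeparatingDual.eq_iff_forall_dual_eq (R := 𝕜)).2 fun f => by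
        rw [map_smul f, ← h, ← h]; rfl)
      (fun m w z => (SeparatingDual.eq_iff_forall_dual_eq (R := 𝕜)).2 fun f => by
        rw [map_add f, ← h, ← h, ← h, map_add T, ContinuousLinearMap.comp_add, map_add])
      (fun c m w => (SeparatingDual.eq_iff_forall_dual_eq (R := 𝕜)).2 fun f => by
        rw [map_smul f, ← h, ← h, map_smul T, ContinuousLinearMap.comp_smul, map_smul]))
    ‖T‖ fun m w => NormedSpace.norm_le_dual_bound 𝕜 _ (by positivity) fun f => by
      rw [LinearMap.mk₂_apply, ← h]
      calc ‖m (f ∘L T w)‖ ≤ ‖m‖ * (‖f‖ * (‖T‖ * ‖w‖)) :=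
            (m.le_opNorm _).trans <| by
              gcongr
              exact (f.opNorm_comp_le _).trans (by gcongr; exact T.le_opNorm w)
        _ = ‖T‖ * ‖m‖ * ‖w‖ * ‖f‖ := by ring

theorem apply_bidualExtension (T : W →L[𝕜] V →L[𝕜] Z)
    (hT : ∀ w, T w ∈ weaklyCompactOperators 𝕜 V Z) (m : StrongDual 𝕜 (StrongDual 𝕜 V)) (w : W)
    (f : StrongDual 𝕜 Z) : f (bidualExtension T hT m w) = m (f ∘L T w) :=
  ((mem_weaklyCompactOperators.1 (hT w) m).choose_spec f).symm

theorem bidualExtension_inclusion (T : W →L[𝕜] V →L[𝕜] Z)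
    (hT : ∀ w, T w ∈ weaklyCompactOperators 𝕜 V Z) (v : V) (w : W) :
    bidualExtension T hT (NormedSpace.inclusionInDoubleDual 𝕜 V v) w = T w v :=
  (SeparatingDual.eq_iff_forall_dual_eq (R := 𝕜)).2 fun f => apply_bidualExtension T hT _ w f

end BilinearExtension

section NormalExtension

open SecondDual

variable {𝕜 : Type} [RCLike 𝕜]
variable {A : Type u} [NonUnitalNormedRing A] [NormedSpace 𝕜 A]
variable {Y : Type u} [NormedAddCommGroup Y] [NormedSpace 𝕜 Y]

namespace BanachBimodule

/-- The bimodule `Y` has weakly compact orbit maps `a ↦ a · y` and `a ↦ y · a`. -/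
structure HasWeaklyCompactOrbits (M : BanachBimodule 𝕜 A Y) : Prop where
  left : ∀ y, M.left.flip y ∈ weaklyCompactOperators 𝕜 A Y
  right : ∀ y, M.right.flip y ∈ weaklyCompactOperators 𝕜 A Y

variable {M : BanachBimodule 𝕜 A Y} (hM : M.HasWeaklyCompactOrbits)

theorem HasWeaklyCompactOrbits.apply_left (m : SecondDual 𝕜 A) (y : Y) (f : StrongDual 𝕜 Y) :
    f (bidualExtension M.left.flip hM.left m y) = m (f ∘L M.left.flip y) :=
  apply_bidualExtension M.left.flip hM.left m y f

theorem HasWeaklyCompactOrbits.apply_right (m : SecondDual 𝕜 A) (y : Y) (f : StrongDual 𝕜 Y) :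
    f (bidualExtension M.right.flip hM.right m y) = m (f ∘L M.right.flip y) :=
  apply_bidualExtension M.right.flip hM.right m y f

variable [IsScalarTower 𝕜 A A] [SMulCommClass 𝕜 A A]

/-- An `A`-bimodule with weakly compact orbit maps is an `A**`-bimodule, with the actions
`⟨f, m · y⟩ = ⟨m, a ↦ ⟨f, a · y⟩⟩` and `⟨f, y · m⟩ = ⟨m, a ↦ ⟨f, y · a⟩⟩`. Associativity of the
right action and `(m · y) · n = m · (y · n)` hold because the functionals `m` and `n` can be
interchanged along a weakly compact orbit map. -/
noncomputable def HasWeaklyCompactOrbits.extension : BanachBimodule 𝕜 (SecondDual 𝕜 A) Y where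
  left := bidualExtension M.left.flip hM.left
  right := bidualExtension M.right.flip hM.right
  left_mul m n y := (SeparatingDual.eq_iff_forall_dual_eq (R := 𝕜)).2 fun f => by
    rw [hM.apply_left, hM.apply_left, mul_apply]
    congr 1
    ext a
    have h1 : dualMul (f ∘L M.left.flip y) a = (f ∘L M.left a) ∘L M.left.flip y := by
      ext b
      exact congrArg f (M.left_mul a b y)
    rw [bidualMul_apply, h1, ← hM.apply_left]
    rfl
  right_mul m n y := (SeparatingDual.eq_iff_forall_dual_eq (R := 𝕜)).2 fun f => by
    let T : Y →L[𝕜] StrongDual 𝕜 A := (ContinuousLinearMap.compL 𝕜 A Y 𝕜 f) ∘L M.right.flip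
    rw [hM.apply_right, hM.apply_right, mul_apply]
    have h1 : bidualMul n (f ∘L M.right.flip y) = n ∘L (T ∘L M.right.flip y) := by
      ext a
      rw [bidualMul_apply]
      refine congrArg n (ContinuousLinearMap.ext fun b => ?_)
      exact congrArg f (M.right_mul a b y)
    rw [h1, interchange_of_mem_weaklyCompactOperators (hM.right y)]
    congr 1
    ext b
    exact (hM.apply_right m y (f ∘L M.right b)).symm
  left_right m n y := (SeparatingDual.eq_iff_forall_dual_eq (R := 𝕜)).2 fun f => by
    let T : Y →L[𝕜] StrongDual 𝕜 A := (ContinuousLinearMap.compL 𝕜 A Y 𝕜 f) ∘L M.right.flip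
    rw [hM.apply_left, hM.apply_right]
    have h1 : f ∘L M.left.flip (bidualExtension M.right.flip hM.right n y) =
        n ∘L (T ∘L M.left.flip y) := by
      ext a
      refine (hM.apply_right n y (f ∘L M.left a)).trans (congrArg n ?_)
      ext b
      exact congrArg f (M.left_right a b y)
    rw [h1, interchange_of_mem_weaklyCompactOperators (hM.left y)]
    congr 1
    ext b
    exact (hM.apply_left m y (f ∘L M.right b)).symm

theorem HasWeaklyCompactOrbits.extension_dualIsNormal :
    hM.extension.DualIsNormal (𝕜 := 𝕜) (B := SecondDual 𝕜 A) (P := StrongDual 𝕜 A)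
      (predualIso 𝕜 A) := fun f =>
  ⟨isWeakStarContinuous_of_forall_exists fun y =>
      ⟨f ∘L M.right.flip y, fun m => hM.apply_right m y f⟩,
    isWeakStarContinuous_of_forall_exists fun y =>
      ⟨f ∘L M.left.flip y, fun m => hM.apply_left m y f⟩⟩

/-- The weak*-continuous extension to `A**` of a derivation from `A`. -/
noncomputable def derivationExtension (D : A →L[𝕜] StrongDual 𝕜 Y) :
    SecondDual 𝕜 A →L[𝕜] StrongDual 𝕜 Y :=
  (ContinuousLinearMap.compL 𝕜 Y (StrongDual 𝕜 A) 𝕜).flip D.flip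

theorem HasWeaklyCompactOrbits.isDerivation_derivationExtension {D : A →L[𝕜] StrongDual 𝕜 Y}
    (hD : M.dual.IsDerivation D) : hM.extension.dual.IsDerivation (derivationExtension D) := by
  intro m n
  ext y
  change (m * n) (D.flip y) = n (D.flip (hM.extension.right m y)) +
    m (D.flip (hM.extension.left n y))
  have h1 : bidualMul n (D.flip y) =
      n ∘L (D.flip ∘L M.right.flip y) + D.flip (hM.extension.left n y) := by
    ext a
    have h2 : dualMul (D.flip y) a = D.flip (M.right a y) + D a ∘L M.left.flip y := by
      ext b
      exact DFunLike.congr_fun (hD a b) y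
    rw [bidualMul_apply, h2, map_add, ← hM.apply_left]
    rfl
  have h3 : m ∘L (D.flip ∘L M.right.flip y).flip = D.flip (hM.extension.right m y) := by
    ext b
    exact (hM.apply_right m y (D b)).symm
  rw [mul_apply, h1, map_add, interchange_of_mem_weaklyCompactOperators (hM.right y), h3]

/-- Connes-amenability of `A**` makes derivations from `A` inner when the orbit maps of the
module are weakly compact. -/
theorem HasWeaklyCompactOrbits.isInner (hM : M.HasWeaklyCompactOrbits) [CompleteSpace Y]
    (h : IsConnesAmenable (𝕜 := 𝕜) (B := SecondDual 𝕜 A) (P := StrongDual 𝕜 A)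
      (predualIso 𝕜 A)) {D : A →L[𝕜] StrongDual 𝕜 Y} (hD : M.dual.IsDerivation D) :
    M.dual.IsInner D := by
  obtain ⟨ψ, hψ⟩ := h Y hM.extension hM.extension_dualIsNormal (derivationExtension D)
    (hM.isDerivation_derivationExtension hD)
    (isWeakStarContinuous_of_forall_exists fun y => ⟨D.flip y, fun _ => rfl⟩)
  refine ⟨ψ, fun a => ContinuousLinearMap.ext fun y => ?_⟩
  exact (DFunLike.congr_fun (hψ (embed 𝕜 A a)) y).trans <|
    congrArg₂ (fun s t : 𝕜 => s - t)
      (congrArg ψ (bidualExtension_inclusion M.right.flip hM.right a y))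
      (congrArg ψ (bidualExtension_inclusion M.left.flip hM.left a y))

end BanachBimodule

end NormalExtension

/-! ### The essential part of a bimodule -/

namespace BanachBimodule

section Essential

variable {𝕜 : Type} [RCLike 𝕜]
variable {A : Type u} [NonUnitalNormedRing A] [NormedSpace 𝕜 A]
variable {X : Type u} [NormedAddCommGroup X] [NormedSpace 𝕜 X]
variable (M : BanachBimodule 𝕜 A X)

/-- The essential part of a bimodule `X`: the closed linear span of `A X A`. -/
def essentialPart : Submodule 𝕜 X :=
  (Submodule.span 𝕜 {z | ∃ a x b, M.left a (M.right b x) = z}).topologicalClosure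

theorem left_right_mem_essentialPart (a : A) (x : X) (b : A) :
    M.left a (M.right b x) ∈ M.essentialPart :=
  Submodule.le_topologicalClosure _ (Submodule.subset_span ⟨a, x, b, rfl⟩)

variable {M} in
theorem essentialPart_le {S : Submodule 𝕜 X} (hS : IsClosed (S : Set X))
    (h : ∀ a x b, M.left a (M.right b x) ∈ S) : M.essentialPart ≤ S := by
  refine Submodule.topologicalClosure_minimal _ (Submodule.span_le.2 ?_) hS
  rintro _ ⟨a, x, b, rfl⟩
  exact h a x b

theorem isClosed_essentialPart : IsClosed (M.essentialPart : Set X) :=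
  Submodule.isClosed_topologicalClosure _

theorem left_mem_essentialPart (a : A) {y : X} (hy : y ∈ M.essentialPart) :
    M.left a y ∈ M.essentialPart := by
  refine essentialPart_le (S := M.essentialPart.comap (M.left a).toLinearMap)
    (M.isClosed_essentialPart.preimage (M.left a).continuous) (fun b x c => ?_) hy
  change M.left a (M.left b (M.right c x)) ∈ M.essentialPart
  rw [← M.left_mul]
  exact M.left_right_mem_essentialPart _ _ _

theorem right_mem_essentialPart (a : A) {y : X} (hy : y ∈ M.essentialPart) :
    M.right a y ∈ M.essentialPart := by
  refine essentialPart_le (S := M.essentialPart.comap (M.right a).toLinearMap)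
    (M.isClosed_essentialPart.preimage (M.right a).continuous) (fun b x c => ?_) hy
  change M.right a (M.left b (M.right c x)) ∈ M.essentialPart
  rw [← M.left_right, ← M.right_mul]
  exact M.left_right_mem_essentialPart _ _ _

/-- The essential part of a bimodule, as a bimodule. -/
noncomputable def essential : BanachBimodule 𝕜 A M.essentialPart where
  left := LinearMap.mkContinuous₂
    (LinearMap.mk₂ 𝕜 (fun a y => ⟨M.left a y, M.left_mem_essentialPart a y.2⟩)
      (fun _ _ _ => Subtype.ext (by simp)) (fun _ _ _ => Subtype.ext (by simp))
      (fun _ _ _ => Subtype.ext (by simp)) (fun _ _ _ => Subtype.ext (by simp)))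
    ‖M.left‖ fun a y => M.left.le_opNorm₂ a y
  right := LinearMap.mkContinuous₂
    (LinearMap.mk₂ 𝕜 (fun a y => ⟨M.right a y, M.right_mem_essentialPart a y.2⟩)
      (fun _ _ _ => Subtype.ext (by simp)) (fun _ _ _ => Subtype.ext (by simp))
      (fun _ _ _ => Subtype.ext (by simp)) (fun _ _ _ => Subtype.ext (by simp)))
    ‖M.right‖ fun a y => M.right.le_opNorm₂ a y
  left_mul a b y := Subtype.ext (M.left_mul a b y)
  right_mul a b y := Subtype.ext (M.right_mul a b y)
  left_right a b y := Subtype.ext (M.left_right a b y)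

theorem mem_of_isClosed_of_left_right_mem {S : Submodule 𝕜 M.essentialPart}
    (hS : IsClosed (S : Set M.essentialPart))
    (h : ∀ a x b, ⟨M.left a (M.right b x), M.left_right_mem_essentialPart a x b⟩ ∈ S)
    (y : M.essentialPart) : y ∈ S := by
  have hc : IsClosed (S.map M.essentialPart.subtype : Set X) :=
    M.isClosed_essentialPart.isClosedEmbedding_subtypeVal.isClosedMap _ hS
  obtain ⟨z, hz, hzy⟩ := essentialPart_le hc
    (fun a x b => Submodule.mem_map_of_mem (h a x b)) y.2
  exact Subtype.ext hzy ▸ hz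

end Essential

section Ideal

open SecondDual

variable {𝕜 : Type} [RCLike 𝕜]
variable {A : Type u} [NonUnitalNormedRing A] [NormedSpace 𝕜 A]
  [IsScalarTower 𝕜 A A] [SMulCommClass 𝕜 A A]
variable {X : Type u} [NormedAddCommGroup X] [NormedSpace 𝕜 X]
variable (M : BanachBimodule 𝕜 A X)

/-- On a generator `a · x · b`, the two orbit maps factor through `c ↦ c a` and `c ↦ b c`, which
are weakly compact because `A` is an ideal in `A**`. -/
theorem essential_hasWeaklyCompactOrbits [CompleteSpace X] (hideal : IsIdealInSecondDual 𝕜 A) :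
    M.essential.HasWeaklyCompactOrbits := by
  have : CompleteSpace M.essentialPart := M.isClosed_essentialPart.completeSpace_coe
  constructor
  · refine M.mem_of_isClosed_of_left_right_mem
      (S := (weaklyCompactOperators 𝕜 A M.essentialPart).comap M.essential.left.flip.toLinearMap)
      (isClosed_weaklyCompactOperators.preimage M.essential.left.flip.continuous) fun a x b => ?_
    change M.essential.left.flip _ ∈ weaklyCompactOperators 𝕜 A M.essentialPart
    have h := comp_mem_weaklyCompactOperators (mulRight_mem_weaklyCompactOperators hideal a)
      ((M.left.flip (M.right b x)).codRestrict M.essentialPart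
        fun c => M.left_right_mem_essentialPart c x b)
    convert h using 1
    ext c
    exact (M.left_mul c a _).symm
  · refine M.mem_of_isClosed_of_left_right_mem
      (S := (weaklyCompactOperators 𝕜 A M.essentialPart).comap M.essential.right.flip.toLinearMap)
      (isClosed_weaklyCompactOperators.preimage M.essential.right.flip.continuous) fun a x b => ?_
    change M.essential.right.flip _ ∈ weaklyCompactOperators 𝕜 A M.essentialPart
    have h := comp_mem_weaklyCompactOperators (mulLeft_mem_weaklyCompactOperators hideal b)
      ((M.left a ∘L M.right.flip x).codRestrict M.essentialPart
        fun c => M.left_right_mem_essentialPart a x c)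
    convert h using 1
    ext c
    change M.right c (M.left a (M.right b x)) = M.left a (M.right (b * c) x)
    rw [M.right_mul, ← M.left_right]

variable {M}

/-- A derivation `D` which vanishes on the essential part of the module is inner. With `θ` the
limit of `D` along a net converging weak* to the mixed identity `E`, the derivation identity
gives `D a = a · θ + θ · a`, and `θ` is annihilated on `A X A`; so `D` is implemented by the
difference of the averages of `θ` over `E` on either side. -/
theorem isInner_of_vanishing_on_essentialPart {E : SecondDual 𝕜 A} (hE : IsMixedIdentity 𝕜 A E)
    {D : A →L[𝕜] StrongDual 𝕜 X} (hD : M.dual.IsDerivation D)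
    (hzero : ∀ a b x c, D a (M.left b (M.right c x)) = 0) : M.dual.IsInner D := by
  have haE (a : A) (f : StrongDual 𝕜 A) : E (dualMul f a) = f a := DFunLike.congr_fun (hE.1 a) f
  have hEa (a : A) (f : StrongDual 𝕜 A) : E ((dualMul f).flip a) = f a :=
    DFunLike.congr_fun (hE.2 a) f
  have hDab (a b : A) (x : X) : D (a * b) x = D b (M.right a x) + D a (M.left b x) :=
    DFunLike.congr_fun (hD a b) x
  let θ : StrongDual 𝕜 X := E ∘L D.flip
  have hθ (a : A) (x : X) (b : A) : θ (M.left a (M.right b x)) = 0 := by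
    have : D.flip (M.left a (M.right b x)) = 0 := ContinuousLinearMap.ext fun c => hzero c a x b
    exact (congrArg E this).trans (map_zero E)
  have hDleft (a b : A) (x : X) : D a (M.left b x) = θ (M.left (a * b) x) := by
    have : (dualMul (D.flip (M.left b x))).flip a = D.flip (M.left (a * b) x) := by
      ext c
      change D (c * a) (M.left b x) = D c (M.left (a * b) x)
      rw [hDab, ← M.left_right, hzero, zero_add, M.left_mul]
    exact (hEa a (D.flip (M.left b x))).symm.trans (congrArg E this)
  have hDθ (a : A) (x : X) : D a x = θ (M.right a x) + θ (M.left a x) := by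
    have : dualMul (D.flip x) a = D.flip (M.right a x) + dualMul (θ ∘L M.left.flip x) a := by
      ext b
      exact (hDab a b x).trans (congrArg _ (hDleft a b x))
    have h := haE a (D.flip x)
    rw [this, map_add, haE] at h
    exact h.symm
  let r : X →L[𝕜] StrongDual 𝕜 A := ContinuousLinearMap.compL 𝕜 A X 𝕜 θ ∘L M.right.flip
  let l : X →L[𝕜] StrongDual 𝕜 A := ContinuousLinearMap.compL 𝕜 A X 𝕜 θ ∘L M.left.flip
  refine ⟨E ∘L r - E ∘L l, fun a => ContinuousLinearMap.ext fun x => ?_⟩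
  change D a x = (E (r (M.right a x)) - E (l (M.right a x))) -
    (E (r (M.left a x)) - E (l (M.left a x)))
  have h1 : r (M.right a x) = dualMul (θ ∘L M.right.flip x) a :=
    ContinuousLinearMap.ext fun b => congrArg θ (M.right_mul a b x).symm
  have h2 : l (M.right a x) = 0 := ContinuousLinearMap.ext fun b => hθ b x a
  have h3 : r (M.left a x) = 0 :=
    ContinuousLinearMap.ext fun b => (congrArg θ (M.left_right a b x).symm).trans (hθ a x b)
  have h4 : l (M.left a x) = (dualMul (θ ∘L M.left.flip x)).flip a :=
    ContinuousLinearMap.ext fun b => congrArg θ (M.left_mul b a x).symm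
  rw [h1, h2, h3, h4, haE, hEa, map_zero, sub_zero, zero_sub, sub_neg_eq_add]
  exact hDθ a x

end Ideal

end BanachBimodule

/-! ### From Connes-amenability of `A**` to amenability of `A` -/

section ConnesToAmenable

open SecondDual

variable {𝕜 : Type} [RCLike 𝕜]
variable {A : Type u} [NonUnitalNormedRing A] [NormedSpace 𝕜 A]
  [IsScalarTower 𝕜 A A] [SMulCommClass 𝕜 A A]

theorem IsConnesAmenable.isAmenable (hideal : IsIdealInSecondDual 𝕜 A)
    (hreg : IsArensRegular 𝕜 A)
    (h : IsConnesAmenable (𝕜 := 𝕜) (B := SecondDual 𝕜 A) (P := StrongDual 𝕜 A)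
      (predualIso 𝕜 A)) : IsAmenable 𝕜 A := by
  intro X _ _ _ M D hD
  obtain ⟨E, hE⟩ := h.exists_isMixedIdentity hreg
  have : CompleteSpace M.essentialPart := M.isClosed_essentialPart.completeSpace_coe
  let D₁ : A →L[𝕜] StrongDual 𝕜 M.essentialPart :=
    (ContinuousLinearMap.compL 𝕜 M.essentialPart X 𝕜).flip M.essentialPart.subtypeL ∘L D
  have hD₁ : M.essential.dual.IsDerivation D₁ := fun a b =>
    ContinuousLinearMap.ext fun y => DFunLike.congr_fun (hD a b) (y : X)
  obtain ⟨ψ₀, hψ₀⟩ := (M.essential_hasWeaklyCompactOrbits hideal).isInner h hD₁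
  obtain ⟨ψ, hψ, -⟩ := exists_extension_norm_eq M.essentialPart ψ₀
  let D₂ : A →L[𝕜] StrongDual 𝕜 X := D - (M.dual.left.flip ψ - M.dual.right.flip ψ)
  have hD₂ : M.dual.IsDerivation D₂ := by
    intro a b
    simp only [D₂, sub_apply, ContinuousLinearMap.flip_apply, map_sub,
      hD a b, M.dual.left_mul, M.dual.right_mul, M.dual.left_right]
    abel
  have hzero (a b : A) (x : X) (c : A) : D₂ a (M.left b (M.right c x)) = 0 := by
    have hy := M.left_right_mem_essentialPart b x c
    have h1 := DFunLike.congr_fun (hψ₀ a) (⟨_, hy⟩ : M.essentialPart)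
    refine sub_eq_zero.2 (h1.trans (congrArg₂ (fun s t : 𝕜 => s - t) ?_ ?_))
    · exact (hψ (M.essential.right a ⟨_, hy⟩)).symm
    · exact (hψ (M.essential.left a ⟨_, hy⟩)).symm
  obtain ⟨η, hη⟩ := BanachBimodule.isInner_of_vanishing_on_essentialPart hE hD₂ hzero
  refine ⟨η + ψ, fun a => ?_⟩
  have h1 : D a = D₂ a + (M.dual.left a ψ - M.dual.right a ψ) := (sub_add_cancel _ _).symm
  rw [h1, hη, map_add, map_add]
  abel

theorem IsConnesAmenableAllDual.isConnesAmenable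
    (h : IsConnesAmenableAllDual (𝕜 := 𝕜) (B := SecondDual 𝕜 A) (P := StrongDual 𝕜 A)
      (predualIso 𝕜 A)) :
    IsConnesAmenable (𝕜 := 𝕜) (B := SecondDual 𝕜 A) (P := StrongDual 𝕜 A)
      (predualIso 𝕜 A) :=
  fun X _ _ _ M _ D => h X M D

end ConnesToAmenable

theorem mainTheorem10 {𝕜 : Type} [RCLike 𝕜] (A : Type u) [NonUnitalNormedRing A]
    [NormedSpace 𝕜 A] [IsScalarTower 𝕜 A A] [SMulCommClass 𝕜 A A] [CompleteSpace A]
    (hideal : SecondDual.IsIdealInSecondDual 𝕜 A)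
    (hfactors : (BanachBimodule.regular 𝕜 A).dual.FactorsLeft ∨
      (BanachBimodule.regular 𝕜 A).dual.FactorsRight) :
    IsDualBanachAlgebra (𝕜 := 𝕜) (B := SecondDual 𝕜 A) (P := StrongDual 𝕜 A) (SecondDual.predualIso 𝕜 A) ∧
    (IsAmenable 𝕜 A ↔ IsConnesAmenable (𝕜 := 𝕜) (B := SecondDual 𝕜 A) (P := StrongDual 𝕜 A) (SecondDual.predualIso 𝕜 A)) ∧
    (IsAmenable 𝕜 A ↔ IsConnesAmenableAllDual (𝕜 := 𝕜) (B := SecondDual 𝕜 A) (P := StrongDual 𝕜 A) (SecondDual.predualIso 𝕜 A)) := by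
  have hreg := isArensRegular_of_factors hideal hfactors
  exact ⟨hreg.isDualBanachAlgebra,
    ⟨fun h => (h.isConnesAmenableAllDual hideal hreg).isConnesAmenable,
      fun h => h.isAmenable hideal hreg⟩,
    ⟨fun h => h.isConnesAmenableAllDual hideal hreg,
      fun h => h.isConnesAmenable.isAmenable hideal hreg⟩⟩
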